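/- Let $0\le r\le n$ be integers, and write $\overline{\mathcal M}_{r,n}$ for the set of matroids of rank $r$ on the labelled ground set $[n]$. A cyclic flat of a matroid is a flat that is a (possibly empty) union of circuits. A Schubert matroid is a matroid whose cyclic flats form a chain under inclusion. Let $\overline{\mathcal S}_{r,n}\subseteq\overline{\mathcal M}_{r,n}$ be the set of Schubert matroids. For $\mathsf M\in\overline{\mathcal M}_{r,n}$, let $\mathcal C_{\mathscr Z}(\mathsf M)$ be the poset whose elements are the chains of cyclic flats of $\mathsf M$ that contain the minimal and the maximal cyclic flat, ordered by containment, together with a new top element $\widehat{\mathbf 1}$. With $\mu$ the Möbius function of this poset, put $\lambda_{\mathrm C}=-\mu(\mathrm C,\widehat{\mathbf 1})$ for each such chain $\mathrm C$, and let $\mathsf S_{\mathrm C}\in\overline{\mathcal S}_{r,n}$ be the unique Schubert matroid whose cyclic flats are exactly the members of $\mathrm C$, with the same ranks as in $\mathsf M$. Let $\overline p_{\mathsf M}\in\mathbb Z^{\overline{\mathcal S}_{r,n}}$ be the point whose coordinate at $\mathsf S_{\mathrm C}$ is $\lambda_{\mathrm C}$ for every such chain $\mathrm C$, all other coordinates being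 $0$, and let $$\overline\Omega_{r,n}=\operatorname{conv}\left(\overline p_{\mathsf N}:\mathsf N\in\overline{\mathcal M}_{r,n}\right)\subseteq\mathbb R^{\overline{\mathcal S}_{r,n}}.$$ A function $f:\overline{\mathcal M}_{r,n}\to\mathbb Z$ is valuative if $\sum_i a_i f(\mathsf M_i)=0$ for all finite families of integers $a_i$ and matroids $\mathsf M_i\in\overline{\mathcal M}_{r,n}$ for which $\sum_i a_i\mathbf 1_{\mathscr P(\mathsf M_i)}$ is identically zero on $\mathbb R^n$. Here $\mathscr P(\mathsf M)$ is the base polytope, the convex hull of the zero-one indicator vectors of the bases of $\mathsf M$. For $B\subseteq[n]$ with $|B|=r$, let $f_B(\mathsf N)=1$ if $B$ is a basis of $\mathsf N$, and $f_B(\mathsf N)=0$ otherwise. **Theorem.** For every $\mathsf M\in\overline{\mathcal M}_{r,n}$, the point $\overline p_{\mathsf M}$ is a vertex (extreme point) of $\overline\Omega_{r,n}$. Moreover, let $$g(\mathsf N)=\sum_{B\text{ a basis of }\mathsf M}f_B(\mathsf N)+\sum_{\substack{B\subseteq[n],\ |B|=r\\ B\text{ not a basis of }\mathsf M}}\bigl(1-f_B(\mathsf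 N)\bigr)\qquad(\mathsf N\in\overline{\mathcal M}_{r,n}).$$ Then $g$ is valuative, $g(\mathsf M)=\binom nr$, and $g(\mathsf N)<\binom nr$ for every $\mathsf N\in\overline{\mathcal M}_{r,n}$ with $\mathsf N\neq\mathsf M$. Furthermore, there is a linear functional $\varphi$ on $\mathbb R^{\overline{\mathcal S}_{r,n}}$ such that $\varphi(\overline p_{\mathsf N})=g(\mathsf N)$ for all $\mathsf N\in\overline{\mathcal M}_{r,n}$, and $\varphi(x)<\binom nr$ for every $x\in\overline\Omega_{r,n}$ with $x\ne\overline p_{\mathsf M}$. -/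

import Mathlib

/-- Matroids of rank `r` on the labelled ground set `[n]` (realised as `Fin n`). -/
def LabelledMatroid (r n : ℕ) : Type :=
  {M : Matroid (Fin n) // M.E = Set.univ ∧ M.eRank = (r : ℕ∞)}

/-- A cyclic flat: a flat which is a (possibly empty) union of circuits. -/
def IsCyclicFlat {α : Type*} (M : Matroid α) (F : Set α) : Prop :=
  M.IsFlat F ∧ ∃ 𝒞 : Set (Set α), (∀ C ∈ 𝒞, M.IsCircuit C) ∧ F = ⋃₀ 𝒞

/-- The poset of cyclic flats of `M`, ordered by inclusion. -/
abbrev CyclicFlats {α : Type*} (M : Matroid α) : Type _ :=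
  {F : Set α // IsCyclicFlat M F}

/-- A Schubert matroid: its cyclic flats form a chain. -/
def IsSchubert {α : Type*} (M : Matroid α) : Prop :=
  IsChain (· ⊆ ·) {F : Set α | IsCyclicFlat M F}

/-- Schubert matroids of rank `r` on `[n]`. -/
def SchubertMatroid (r n : ℕ) : Type :=
  {S : LabelledMatroid r n // IsSchubert S.1}

/-- The chains of a poset `P` that contain the minimum and the maximum of `P`,
ordered by containment. -/
abbrev BoundedChain (P : Type*) [PartialOrder P] : Type _ :=
  {C : Set P // IsChain (· ≤ ·) C ∧ (∀ x, IsBot x → x ∈ C) ∧ (∀ x, IsTop x → x ∈ C)}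

/-- The chain lattice of `P`: the chains of `P` containing its minimum and maximum,
with a new top element adjoined. -/
abbrev ChainLattice (P : Type*) [PartialOrder P] : Type _ :=
  WithTop (BoundedChain P)

open Classical in
/-- The Möbius function of a finite poset. -/
noncomputable def moebiusFn {P : Type*} [PartialOrder P] [Finite P] (x y : P) : ℤ :=
  letI : Fintype P := Fintype.ofFinite P
  letI : LocallyFiniteOrder P := Fintype.toLocallyFiniteOrder
  IncidenceAlgebra.mu ℤ x y

/-- `λ_C = -μ(C, 1̂)`, with `μ` the Möbius function of the chain lattice of the cyclic flats
of `M`. -/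
noncomputable def chainCoeff {n : ℕ} (M : Matroid (Fin n))
    (C : BoundedChain (CyclicFlats M)) : ℤ :=
  -moebiusFn (P := ChainLattice (CyclicFlats M)) (C : ChainLattice (CyclicFlats M)) ⊤

/-- `S` is the matroid `S_C`: its cyclic flats are exactly the members of the chain `C` of
cyclic flats of `M`, with the ranks that they have in `M`. -/
def IsChainMatroid {α : Type*} (M : Matroid α) (C : BoundedChain (CyclicFlats M))
    (S : Matroid α) : Prop :=
  {F : Set α | IsCyclicFlat S F} = Subtype.val '' C.1 ∧
    ∀ F ∈ C.1, S.eRk F.1 = M.eRk F.1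

open Classical in
/-- The Schubert coordinates of `M`: the vector `∑_C λ_C e_{S_C}`, the sum being over the chains
`C` of cyclic flats of `M` containing the minimal and the maximal cyclic flat. The chain `C` is
determined by `S_C`, so the coordinate at `S_C` is `λ_C` and all the other ones are zero. -/
noncomputable def schubertCoord {r n : ℕ} (M : LabelledMatroid r n)
    (S : SchubertMatroid r n) : ℤ :=
  letI : Fintype (BoundedChain (CyclicFlats M.1)) := Fintype.ofFinite _
  ∑ C : BoundedChain (CyclicFlats M.1),
    if IsChainMatroid M.1 C S.1.1 then chainCoeff M.1 C else 0

/-- The point `p̄_M`, regarded in the real coordinate space. -/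
noncomputable def schubertPoint {r n : ℕ} (M : LabelledMatroid r n) :
    SchubertMatroid r n → ℝ :=
  fun S => (schubertCoord M S : ℝ)

/-- The polytope `Ω̄_{r,n}` of all matroids of rank `r` on `[n]`. -/
def omegaBar (r n : ℕ) : Set (SchubertMatroid r n → ℝ) :=
  convexHull ℝ (Set.range (schubertPoint (r := r) (n := n)))

/-- The base polytope: the convex hull of the zero-one indicator vectors of the bases. -/
def basePolytope {n : ℕ} (M : Matroid (Fin n)) : Set (Fin n → ℝ) :=
  convexHull ℝ {x | ∃ B : Set (Fin n), M.IsBase B ∧ x = B.indicator 1}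

/-- Valuative functions: those respecting every integer linear relation between the indicator
functions of base polytopes. -/
def IsValuative {r n : ℕ} {A : Type*} [AddCommGroup A] (f : LabelledMatroid r n → A) : Prop :=
  ∀ (s : ℕ) (a : Fin s → ℤ) (M : Fin s → LabelledMatroid r n),
    (∀ x : Fin n → ℝ, ∑ i, a i * (basePolytope (M i).1).indicator (1 : (Fin n → ℝ) → ℤ) x = 0) →
      ∑ i, a i • f (M i) = 0

open Classical in
/-- The basis indicator function `f_B`. -/
noncomputable def basisIndicator {r n : ℕ} (B : Finset (Fin n)) (N : LabelledMatroid r n) : ℤ :=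
  if N.1.IsBase (B : Set (Fin n)) then 1 else 0

open Classical in
/-- The sum of `f_B(N)` over the bases `B` of `M` and of `1 - f_B(N)` over the `r`-subsets `B`
of `[n]` that are not bases of `M`. -/
noncomputable def basisAgreement {r n : ℕ} (M N : LabelledMatroid r n) : ℤ :=
  ∑ B ∈ Finset.powersetCard r (Finset.univ : Finset (Fin n)),
    if M.1.IsBase (B : Set (Fin n)) then basisIndicator B N else 1 - basisIndicator B N

/-! The functional `φ` weights the coordinate of a Schubert matroid `S` by `g(S)`. Everything rests
on `g(N) = ∑ λ_C g(S_C)`, since `g(N)` counts the `r`-subsets on which `M` and `N` agree and so has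
its strict maximum at `M`; strictness passes to the convex hull and makes the point extreme.

By linearity the expansion reduces to `∑ λ_C = 1` and to `f_B(N) = ∑ λ_C f_B(S_C)`
(`sum_chainCoeff_mul_basisIndicator`). Let `D` be the set of cyclic flats `F` of `N` with `|B ∩ F| >
rk F`. Then `B` is a basis of `S_C` iff `C` avoids `D`, and a basis of `N` iff `D` is empty. The
coefficients of the chains containing a given chain sum to 1, so inclusion-exclusion turns the sum
over chains avoiding `D` into `∑ (-1)^|c|` over the chains `c` in `D`. This is 1 if `D` is empty.
Otherwise the excess `|B ∩ F| - rk F` is supermodular, so `D` is preserved by meeting with a member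
of largest excess, and a toggling involution gives 0.

Valuativity is a separate matter: `f_B` evaluates the indicator function of the polytope at a vertex
of the cube, and the constant 1 is the Euler characteristic of a nonempty compact convex set. -/

/-! ### Möbius coefficients of chains and the order complex -/

section Chains

variable {P : Type*} [PartialOrder P]

open Classical in
/-- The chains with all members in `D`. -/
noncomputable def chainsIn (D : Finset P) : Finset (Finset P) :=
  D.powerset.filter fun c : Finset P => IsChain (· ≤ ·) (c : Set P)

lemma mem_chainsIn {D c : Finset P} :
    c ∈ chainsIn D ↔ c ⊆ D ∧ IsChain (· ≤ ·) (c : Set P) := by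
  simp [chainsIn]

/-- A nonempty finite chain has a least element, so its greatest lower bound together with `m`
is found among the pairwise ones. -/
lemma exists_isGLB_insert_of_isChain {D A : Finset P} {m : P} (hm : m ∈ D)
    (hD : ∀ x ∈ D, ∃ y ∈ D, IsGLB {x, m} y) (hA : IsChain (· ≤ ·) (A : Set P)) (hAD : A ⊆ D) :
    ∃ p ∈ D, IsGLB (insert m (A : Set P)) p := by
  rcases A.eq_empty_or_nonempty with rfl | hne
  · exact ⟨m, hm, by simp⟩
  · obtain ⟨a, ha⟩ := A.exists_minimal hne
    have hle : ∀ b ∈ A, a ≤ b := fun b hb =>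
      (hA.total ha.1 hb).elim id fun h => ha.2 hb h
    obtain ⟨y, hy, hglb⟩ := hD a (hAD ha.1)
    refine ⟨y, hy, ?_, ?_⟩
    · rintro b (rfl | hb)
      · exact hglb.1 (by simp)
      · exact (hglb.1 (by simp : a ∈ ({a, m} : Set P))).trans (hle b hb)
    · intro b hb
      refine hglb.2 ?_
      rintro c (rfl | rfl)
      · exact hb (Or.inr ha.1)
      · exact hb (Or.inl rfl)

/-- With the trivial bound for the members not below `m`, this makes `p` comparable to all of `c`,
so `p` can be added to the chain. -/
lemma le_of_isChain_of_isGLB {c : Set P} {m p b : P} (hc : IsChain (· ≤ ·) c)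
    (hp : IsGLB (insert m {a ∈ c | ¬ a ≤ m}) p) (hb : b ∈ c) (hbm : b ≤ m) : b ≤ p := by
  refine hp.2 ?_
  rintro a (rfl | ⟨ha, ham⟩)
  · exact hbm
  · exact (hc.total hb ha).resolve_right fun h => ham (h.trans hbm)

open Classical in
/-- If meeting with a fixed member `m` of `D` preserves `D`, then the order complex of `D` has
vanishing reduced Euler characteristic. -/
lemma sum_chains_neg_one_pow_card_eq_zero {D : Finset P} {m : P} (hm : m ∈ D)
    (hD : ∀ x ∈ D, ∃ y ∈ D, IsGLB {x, m} y) :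
    ∑ c ∈ chainsIn D, (-1 : ℤ) ^ c.card = 0 := by
  have hex : ∀ c ∈ chainsIn D,
      ∃ p ∈ D, IsGLB (insert m {a ∈ (c : Set P) | ¬ a ≤ m}) p := by
    intro c hc
    rw [mem_chainsIn] at hc
    have := exists_isGLB_insert_of_isChain (A := c.filter fun a => ¬ a ≤ m) hm hD
      (hc.2.mono (Finset.coe_subset.2 (Finset.filter_subset _ _)))
        ((Finset.filter_subset _ _).trans hc.1)
    simpa using this
  choose p hpD hp using hex
  have hpm : ∀ c hc, p c hc ≤ m := fun c hc => (hp c hc).1 (Or.inl rfl)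
  -- The involution toggles `p(c)`, the meet of `m` with the members of `c` not below `m`.
  have key : ∀ c hc, symmDiff c {p c hc} ∈
      chainsIn D := by
    intro c hc
    have hc' := hc
    rw [mem_chainsIn] at hc' ⊢
    have hsub : symmDiff c {p c hc} ⊆ insert (p c hc) c := by
      intro x; simp only [Finset.mem_symmDiff, Finset.mem_singleton, Finset.mem_insert]; tauto
    refine ⟨hsub.trans (Finset.insert_subset (hpD c hc) hc'.1), ?_⟩
    refine IsChain.mono (Finset.coe_subset.2 hsub) ?_
    rw [Finset.coe_insert]
    refine hc'.2.insert fun b hb _ => ?_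
    by_cases hbm : b ≤ m
    · exact Or.inr (le_of_isChain_of_isGLB hc'.2 (hp c hc) hb hbm)
    · exact Or.inl ((hp c hc).1 (Or.inr ⟨hb, hbm⟩))
  -- As `p(c) ≤ m`, toggling it leaves the members not below `m` unchanged, and these determine `p`.
  have hstable : ∀ c hc, p (symmDiff c {p c hc}) (key c hc) = p c hc := by
    intro c hc
    refine (hp _ (key c hc)).unique ?_
    convert hp c hc using 2
    ext a
    simp only [Finset.coe_symmDiff, Finset.coe_singleton, Set.mem_ofPred_eq, Set.mem_symmDiff,
      Finset.mem_coe, Set.mem_singleton_iff]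
    have := hpm c hc
    constructor
    · rintro ⟨h | h, ham⟩
      · exact ⟨h.1, ham⟩
      · exact absurd (h.1 ▸ this) ham
    · rintro ⟨h, ham⟩
      exact ⟨Or.inl ⟨h, fun h' => ham (h' ▸ this)⟩, ham⟩
  refine Finset.sum_involution (fun c hc => symmDiff c {p c hc}) ?_ ?_ key ?_
  · intro c hc
    by_cases h : p c hc ∈ c
    · have h1 : symmDiff c {p c hc} = c.erase (p c hc) := by
        ext x; simp only [Finset.mem_symmDiff, Finset.mem_singleton, Finset.mem_erase]
        by_cases hx : x = p c hc
        · simp [hx, h]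
        · simp [hx]
      have h2 := Finset.card_erase_add_one h
      rw [h1, ← h2, pow_succ]; ring
    · have h1 : symmDiff c {p c hc} = insert (p c hc) c := by
        ext x; simp only [Finset.mem_symmDiff, Finset.mem_singleton, Finset.mem_insert]
        by_cases hx : x = p c hc
        · simp [hx, h]
        · simp [hx]
      rw [h1, Finset.card_insert_of_notMem h, pow_succ]; ring
  · intro c hc _ h
    have : ({p c hc} : Finset P) = ⊥ := symmDiff_eq_left.1 h
    simp at this
  · intro c hc
    simp only [hstable c hc]
    rw [symmDiff_assoc, symmDiff_self, symmDiff_bot]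

open Classical in
lemma sum_moebiusFn_top {Q : Type*} [PartialOrder Q] [OrderTop Q] [Fintype Q] {a : Q}
    (ha : a ≠ ⊤) : ∑ x : Q with a ≤ x, moebiusFn x ⊤ = 0 := by
  let _ : LocallyFiniteOrder Q := Fintype.toLocallyFiniteOrder
  have h := IncidenceAlgebra.sum_Icc_mu_left (𝕜 := ℤ) a (⊤ : Q)
  rw [if_neg ha] at h
  have hI : (Finset.univ.filter fun x : Q => a ≤ x) = Finset.Icc a ⊤ := by ext x; simp
  rw [← h, hI]
  refine Finset.sum_congr rfl fun x _ => ?_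
  unfold moebiusFn
  congr!

lemma moebiusFn_self {Q : Type*} [PartialOrder Q] [Finite Q] (a : Q) : moebiusFn a a = 1 := by
  classical
  let _ : Fintype Q := Fintype.ofFinite Q
  let _ : LocallyFiniteOrder Q := Fintype.toLocallyFiniteOrder
  unfold moebiusFn
  convert IncidenceAlgebra.mu_self (𝕜 := ℤ) a

lemma isChain_union_isBot_isTop {c : Set P} (hc : IsChain (· ≤ ·) c) :
    IsChain (· ≤ ·) (c ∪ {x | IsBot x} ∪ {x | IsTop x}) := by
  rintro x ((hx | hx) | hx) y ((hy | hy) | hy) hxy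
  · exact hc hx hy hxy
  all_goals first
    | exact Or.inl (hx y) | exact Or.inr (hx y) | exact Or.inl (hy x) | exact Or.inr (hy x)

open Classical in
/-- The coefficients `-μ(C, 1̂)` of the bounded chains containing a given chain sum to one. -/
lemma sum_neg_moebiusFn_superset [Finite P] [Fintype (BoundedChain P)] {c : Set P}
    (hc : IsChain (· ≤ ·) c) :
    ∑ C : BoundedChain P with c ⊆ C.1, -moebiusFn (C : ChainLattice P) ⊤ = 1 := by
  -- `C₀` is the least bounded chain containing `c`. The Möbius recursion above it sums to 0, and
  -- the adjoined top contributes 1.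
  let C₀ : BoundedChain P := ⟨_, isChain_union_isBot_isTop hc,
    fun x hx => Or.inl (Or.inr hx), fun x hx => Or.inr hx⟩
  have h := sum_moebiusFn_top (Q := ChainLattice P) (a := (C₀ : ChainLattice P))
    (WithTop.coe_ne_top)
  rw [Finset.sum_filter] at h ⊢
  let F : ChainLattice P → ℤ := fun x => if (C₀ : ChainLattice P) ≤ x then moebiusFn x ⊤ else 0
  have hF : F ⊤ = 1 := (if_pos le_top).trans (moebiusFn_self _)
  have hFC : ∀ C : BoundedChain P,
      F C = if C₀ ≤ C then moebiusFn (C : ChainLattice P) ⊤ else 0 := fun C => by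
    simp only [F, WithTop.coe_le_coe]
  have h2 : ∑ x : ChainLattice P, F x = F ⊤ + ∑ C : BoundedChain P, F C :=
    Fintype.sum_option (α := BoundedChain P) F
  have h4 : ∑ x : ChainLattice P, F x = 0 := by convert h
  rw [h2, hF, Finset.sum_congr rfl fun C _ => hFC C] at h4
  have h3 : ∀ C : BoundedChain P, C₀ ≤ C ↔ c ⊆ C.1 := fun C =>
    ⟨fun hC => (Set.subset_union_left.trans Set.subset_union_left).trans hC,
      fun hC => Set.union_subset (Set.union_subset hC C.2.2.1) C.2.2.2⟩
  simp only [h3] at h4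
  rw [← neg_inj, ← Finset.sum_neg_distrib]
  rw [add_comm, ← eq_neg_iff_add_eq_zero] at h4
  rw [← h4]
  refine Finset.sum_congr rfl fun C _ => ?_
  split_ifs <;> simp

open Classical in
/-- Summing the coefficients `-μ(C, 1̂)` over the bounded chains avoiding `D` yields the negative
of the reduced Euler characteristic of the order complex of `D`. -/
lemma sum_neg_moebiusFn_disjoint [Finite P] [Fintype (BoundedChain P)] (D : Finset P) :
    ∑ C : BoundedChain P with Disjoint C.1 (D : Set P), -moebiusFn (C : ChainLattice P) ⊤ =
      ∑ c ∈ chainsIn D, (-1 : ℤ) ^ c.card := by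
  -- Inclusion-exclusion over the subsets of `C ∩ D`, all of which are chains.
  have h1 : ∀ C : BoundedChain P, (if Disjoint C.1 (D : Set P) then
      -moebiusFn (C : ChainLattice P) ⊤ else 0) =
      ∑ c ∈ chainsIn D,
        (if (c : Set P) ⊆ C.1 then (-1 : ℤ) ^ c.card * -moebiusFn (C : ChainLattice P) ⊤ else 0) := by
    intro C
    rw [← Finset.sum_filter, ← Finset.sum_mul]
    have h2 : (chainsIn D).filter
        (fun c : Finset P => (c : Set P) ⊆ C.1) = (D.filter (· ∈ C.1)).powerset := by
      ext c
      simp only [Finset.mem_filter, mem_chainsIn, Finset.mem_powerset, Finset.subset_iff, Set.subset_def,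
        Finset.mem_coe]
      constructor
      · rintro ⟨⟨h, -⟩, h'⟩ x hx
        exact ⟨h hx, h' x hx⟩
      · intro h
        exact ⟨⟨fun x hx => (h hx).1, C.2.1.mono fun x hx => (h hx).2⟩, fun x hx => (h hx).2⟩
    rw [h2, Finset.sum_powerset_neg_one_pow_card]
    have h3 : Disjoint C.1 (D : Set P) ↔ D.filter (· ∈ C.1) = ∅ := by
      rw [Finset.filter_eq_empty_iff, disjoint_comm, Set.disjoint_left]; simp
    rw [if_congr h3 rfl rfl]
    split_ifs <;> simp
  rw [Finset.sum_filter, Finset.sum_congr rfl fun C _ => h1 C, Finset.sum_comm]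
  refine Finset.sum_congr rfl fun c hc => ?_
  rw [← Finset.sum_filter, ← Finset.mul_sum,
    sum_neg_moebiusFn_superset (mem_chainsIn.1 hc).2, mul_one]

end Chains

/-! ### The lattice of cyclic flats -/

section CyclicFlats

variable {α : Type*} {M : Matroid α} {X Y I : Set α}

/-- The union of the circuits contained in `X`. -/
def cyclicPart (M : Matroid α) (X : Set α) : Set α := ⋃₀ {C | M.IsCircuit C ∧ C ⊆ X}

lemma cyclicPart_subset (M : Matroid α) (X : Set α) : cyclicPart M X ⊆ X :=
  Set.sUnion_subset fun _ hC => hC.2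

lemma Matroid.IsCircuit.subset_cyclicPart {C : Set α} (hC : M.IsCircuit C) (hCX : C ⊆ X) :
    C ⊆ cyclicPart M X :=
  Set.subset_sUnion_of_mem ⟨hC, hCX⟩

lemma cyclicPart_mono (h : X ⊆ Y) : cyclicPart M X ⊆ cyclicPart M Y :=
  Set.sUnion_subset fun _ hC => hC.1.subset_cyclicPart (hC.2.trans h)

lemma isCyclicFlat_iff : IsCyclicFlat M X ↔ M.IsFlat X ∧ cyclicPart M X = X := by
  refine and_congr_right fun _ => ⟨?_, fun h => ⟨_, fun C hC => hC.1, h.symm⟩⟩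
  rintro ⟨𝒞, h𝒞, rfl⟩
  refine (cyclicPart_subset M _).antisymm (Set.sUnion_subset fun C hC => ?_)
  exact (h𝒞 C hC).subset_cyclicPart (Set.subset_sUnion_of_mem hC)

/-- A new element of the closure would lie on a circuit inside the flat `X`, hence already in the
cyclic part. Applied to `X ∩ Y` this provides meets of cyclic flats. -/
lemma Matroid.IsFlat.isCyclicFlat_cyclicPart (hX : M.IsFlat X) :
    IsCyclicFlat M (cyclicPart M X) := by
  refine ⟨?_, _, fun C hC => hC.1, rfl⟩
  have hsub := cyclicPart_subset M X
  have hE : cyclicPart M X ⊆ M.E := hsub.trans hX.subset_ground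
  rw [Matroid.isFlat_iff_closure_eq]
  refine Set.Subset.antisymm (fun e he => ?_) (M.subset_closure _)
  by_contra hne
  obtain ⟨C, hC, hCirc, heC⟩ := Matroid.exists_isCircuit_of_mem_closure he hne
  have heX : e ∈ X := hX.closure ▸ M.closure_subset_closure hsub he
  exact hne (hCirc.subset_cyclicPart (hC.trans (Set.insert_subset heX hsub)) heC)

/-- The closure of a union of circuits is a cyclic flat. -/
lemma isCyclicFlat_closure_of_subset_cyclicPart (h : X ⊆ cyclicPart M X) :
    IsCyclicFlat M (M.closure X) := by
  rw [isCyclicFlat_iff]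
  refine ⟨M.isFlat_closure X, (cyclicPart_subset M _).antisymm fun e he => ?_⟩
  have hE : X ⊆ M.E := h.trans (Set.sUnion_subset fun C hC => hC.1.subset_ground)
  have hcl := M.subset_closure X
  by_cases heX : e ∈ X
  · exact cyclicPart_mono hcl (h heX)
  · obtain ⟨C, hC, hCirc, heC⟩ := Matroid.exists_isCircuit_of_mem_closure he heX
    exact hCirc.subset_cyclicPart (hC.trans (Set.insert_subset he hcl)) heC

lemma Matroid.IsCircuit.isCyclicFlat_closure {C : Set α} (hC : M.IsCircuit C) :
    IsCyclicFlat M (M.closure C) :=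
  isCyclicFlat_closure_of_subset_cyclicPart (hC.subset_cyclicPart subset_rfl)

lemma IsCyclicFlat.closure_union (hX : IsCyclicFlat M X) (hY : IsCyclicFlat M Y) :
    IsCyclicFlat M (M.closure (X ∪ Y)) := by
  refine isCyclicFlat_closure_of_subset_cyclicPart (Set.union_subset ?_ ?_)
  · rw [isCyclicFlat_iff] at hX
    conv_lhs => rw [← hX.2]
    exact cyclicPart_mono Set.subset_union_left
  · rw [isCyclicFlat_iff] at hY
    conv_lhs => rw [← hY.2]
    exact cyclicPart_mono Set.subset_union_right

lemma isCyclicFlat_loops (M : Matroid α) : IsCyclicFlat M M.loops :=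
  isCyclicFlat_closure_of_subset_cyclicPart (Set.empty_subset _)

lemma isTop_cyclicPart_ground (M : Matroid α) :
    IsTop (⟨cyclicPart M M.E, M.ground_isFlat.isCyclicFlat_cyclicPart⟩ : CyclicFlats M) := by
  intro x
  have h := (isCyclicFlat_iff.1 x.2).2
  change x.1 ⊆ _
  rw [← h]
  exact cyclicPart_mono x.2.1.subset_ground

lemma isBot_loops (M : Matroid α) :
    IsBot (⟨M.loops, isCyclicFlat_loops M⟩ : CyclicFlats M) := fun x => by
  change M.loops ⊆ x.1
  rw [← x.2.1.closure]
  exact M.closure_subset_closure (Set.empty_subset _)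

lemma isChain_image_val {M : Matroid α} (C : BoundedChain (CyclicFlats M)) :
    IsChain (· ⊆ ·) (Subtype.val '' C.1 : Set (Set α)) := by
  rintro _ ⟨x, hx, rfl⟩ _ ⟨y, hy, rfl⟩ hxy
  exact C.2.1 hx hy fun h => hxy (h ▸ rfl)

/-- Independence is witnessed by the cyclic flats. -/
lemma indep_iff_forall_isCyclicFlat [M.Finitary] (hI : I ⊆ M.E) (hfin : I.Finite) :
    M.Indep I ↔ ∀ F, IsCyclicFlat M F → (I ∩ F).encard ≤ M.eRk F := by
  refine ⟨fun h F _ => (h.subset Set.inter_subset_left).encard_le_eRk_of_subset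
    Set.inter_subset_right, fun h => ?_⟩
  rw [Matroid.indep_iff_forall_subset_not_isCircuit hI]
  -- The closure of a circuit `C ⊆ I` is a cyclic flat of rank `|C| - 1` that contains `C`, against
  -- the bound.
  intro C hCI hC
  have h1 := h _ hC.isCyclicFlat_closure
  rw [Matroid.eRk_closure_eq] at h1
  have h2 : C.encard ≤ (I ∩ M.closure C).encard :=
    Set.encard_le_encard (Set.subset_inter hCI (M.subset_closure C hC.subset_ground))
  have h3 := hC.eRk_add_one_eq
  have h4 : C.encard ≤ M.eRk C := h2.trans h1
  rw [← h3] at h4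
  have hne : M.eRk C ≠ ⊤ :=
    ((M.eRk_le_encard C).trans_lt (hfin.subset hCI).encard_lt_top).ne
  exact (ENat.add_one_le_iff hne).1 h4 |>.ne rfl

/-- Outside the cyclic part every element contributes to the rank. -/
lemma encard_inter_add_eRk_cyclicPart_le (M : Matroid α) (B X : Set α) (hX : X ⊆ M.E) :
    (B ∩ X).encard + M.eRk (cyclicPart M X) ≤ (B ∩ cyclicPart M X).encard + M.eRk X := by
  set K := cyclicPart M X with hK
  have hKX : K ⊆ X := cyclicPart_subset M X
  obtain ⟨J, hJ⟩ := M.exists_isBasis K (hKX.trans hX)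
  -- A circuit inside `X` lies in `K`, so here it would lie in the independent set `J`.
  have hind : M.Indep (J ∪ (X \ K)) := by
    rw [Matroid.indep_iff_forall_subset_not_isCircuit
      (Set.union_subset hJ.indep.subset_ground (Set.sdiff_subset.trans hX))]
    intro C hCs hC
    have hCK : C ⊆ K := hC.subset_cyclicPart
      (hCs.trans (Set.union_subset (hJ.subset.trans hKX) Set.sdiff_subset))
    have hCJ : C ⊆ J := fun x hx => (hCs hx).elim id fun h => absurd (hCK hx) h.2
    exact hC.not_indep (hJ.indep.subset hCJ)
  have h1 : M.eRk K + (X \ K).encard ≤ M.eRk X := by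
    rw [hJ.eRk_eq_encard, ← Set.encard_union_eq]
    · exact hind.encard_le_eRk_of_subset
        (Set.union_subset (hJ.subset.trans hKX) Set.sdiff_subset)
    · exact Set.disjoint_left.2 fun x hx h => h.2 (hJ.subset hx)
  have h2 : (B ∩ X).encard ≤ (B ∩ K).encard + (X \ K).encard := by
    refine le_trans (Set.encard_le_encard fun x hx => ?_) (Set.encard_union_le _ _)
    by_cases hxK : x ∈ K
    · exact Or.inl ⟨hx.1, hxK⟩
    · exact Or.inr ⟨hx.2, hxK⟩
  calc (B ∩ X).encard + M.eRk K ≤ (B ∩ K).encard + (X \ K).encard + M.eRk K := by gcongr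
    _ = (B ∩ K).encard + (M.eRk K + (X \ K).encard) := by ring
    _ ≤ _ := by gcongr

lemma Matroid.IsFlat.inter (hX : M.IsFlat X) (hY : M.IsFlat Y) : M.IsFlat (X ∩ Y) := by
  rw [Matroid.isFlat_iff_closure_eq]
  refine Set.Subset.antisymm (Set.subset_inter ?_ ?_)
    (M.subset_closure _ (Set.inter_subset_left.trans hX.subset_ground))
  · exact (M.closure_subset_closure Set.inter_subset_left).trans hX.closure.subset
  · exact (M.closure_subset_closure Set.inter_subset_right).trans hY.closure.subset

lemma eRk_eq_natCast [Finite α] (M : Matroid α) (X : Set α) : M.eRk X = ((M.eRk X).toNat : ℕ∞) :=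
  (ENat.natCast_toNat ((M.eRk_le_encard X).trans_lt (Set.toFinite X).encard_lt_top).ne).symm

lemma encard_eq_natCast [Finite α] (X : Set α) : X.encard = (X.ncard : ℕ∞) :=
  (Set.toFinite X).cast_ncard_eq.symm

lemma encard_le_eRk_iff [Finite α] :
    X.encard ≤ M.eRk Y ↔ X.ncard ≤ (M.eRk Y).toNat := by
  rw [eRk_eq_natCast, encard_eq_natCast, Nat.cast_le]; rfl

/-- The members `F` of the lattice of cyclic flats with `|B ∩ F| > rk F` are preserved by meeting
with one for which the excess is largest. -/
lemma exists_forall_isGLB_of_excess [Finite α] (M : Matroid α) (B : Set α)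
    (D : Set (CyclicFlats M)) (hD : D = {F | M.eRk F.1 < (B ∩ F.1).encard}) (hne : D.Nonempty) :
    ∃ m ∈ D, ∀ x ∈ D, ∃ y ∈ D, IsGLB {x, m} y := by
  let rk : Set α → ℤ := fun X => (M.eRk X).toNat
  have hrk := eRk_eq_natCast M
  have hcard := encard_eq_natCast (α := α)
  let e : CyclicFlats M → ℤ := fun F => ((B ∩ F.1).ncard : ℤ) - rk F.1
  have hmem : ∀ F, F ∈ D ↔ 0 < e F := by
    intro F
    rw [hD, Set.mem_ofPred_eq, hrk, hcard, Nat.cast_lt, sub_pos]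
    exact Nat.cast_lt.symm
  have := hne.to_subtype
  obtain ⟨m, hm⟩ := Finite.exists_max (fun F : D => e F.1)
  refine ⟨m.1, m.2, fun x hx => ?_⟩
  have hflat : M.IsFlat (x.1 ∩ m.1.1) := x.2.1.inter m.1.2.1
  let y : CyclicFlats M := ⟨cyclicPart M (x.1 ∩ m.1.1), hflat.isCyclicFlat_cyclicPart⟩
  let z : CyclicFlats M := ⟨M.closure (x.1 ∪ m.1.1), x.2.closure_union m.1.2⟩
  have hyglb : IsGLB {x, m.1} y := by
    refine ⟨?_, fun w hw => ?_⟩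
    · rintro w (rfl | rfl)
      · exact (cyclicPart_subset M _).trans Set.inter_subset_left
      · exact (cyclicPart_subset M _).trans Set.inter_subset_right
    · have hwx : w.1 ⊆ x.1 := hw (by simp)
      have hwm : w.1 ⊆ m.1.1 := hw (by simp)
      have := (isCyclicFlat_iff.1 w.2).2
      change w.1 ⊆ _
      rw [← this]
      exact cyclicPart_mono (Set.subset_inter hwx hwm)
  refine ⟨y, ?_, hyglb⟩
  have h1 := encard_inter_add_eRk_cyclicPart_le M B (x.1 ∩ m.1.1) hflat.subset_ground
  have h2 := M.eRk_inter_add_eRk_union_le x.1 m.1.1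
  have h3 : rk z.1 = rk (x.1 ∪ m.1.1) := by simp [rk, z]
  have h4 : (B ∩ (x.1 ∪ m.1.1)).ncard ≤ (B ∩ z.1).ncard := Set.ncard_le_ncard
    (Set.inter_subset_inter_right _ (M.subset_closure _
      (Set.union_subset x.2.1.subset_ground m.1.2.1.subset_ground)))
  have h5 : (B ∩ (x.1 ∪ m.1.1)).ncard + (B ∩ (x.1 ∩ m.1.1)).ncard =
      (B ∩ x.1).ncard + (B ∩ m.1.1).ncard := by
    rw [Set.inter_union_distrib_left, Set.inter_inter_distrib_left, Set.ncard_union_add_ncard_inter]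
  rw [hcard, hcard, hrk (cyclicPart M _), hrk (x.1 ∩ m.1.1)] at h1
  rw [hrk (x.1 ∩ m.1.1), hrk (x.1 ∪ m.1.1), hrk x.1, hrk m.1.1] at h2
  norm_cast at h1 h2
  -- If the join `z` is outside `D`, its excess is at most 0. With `e y + e z ≥ e x + e m` this
  -- yields `e y ≥ e x > 0`.
  have hz : e z ≤ e m.1 := by
    by_cases hzD : z ∈ D
    · exact hm ⟨z, hzD⟩
    · rw [hmem] at hzD
      have := (hmem m.1).1 m.2
      omega
  have hxe := (hmem x).1 hx
  rw [hmem]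
  have hy : y.1 = cyclicPart M (x.1 ∩ m.1.1) := rfl
  simp only [e, rk] at *
  rw [hy]
  omega

end CyclicFlats

/-! ### Matroids defined by rank bounds on a chain of sets -/

section NestedMatroid

variable {α : Type*} [Finite α]

/-- The matroid on `E` whose independent sets meet each member `F` of a chain of sets in at most
`ρ F` elements. -/
def nestedMatroid (E : Set α) (𝒞 : Set (Set α)) (h𝒞 : IsChain (· ⊆ ·) 𝒞) (ρ : Set α → ℕ) :
    Matroid α :=
  (IndepMatroid.ofFinite (E := E) E.toFinite
    (fun I => I ⊆ E ∧ ∀ F ∈ 𝒞, (I ∩ F).ncard ≤ ρ F)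
    (by simp)
    (fun I J hJ hIJ => ⟨hIJ.trans hJ.1, fun F hF =>
      (Set.ncard_le_ncard (Set.inter_subset_inter_left F hIJ)).trans (hJ.2 F hF)⟩)
    (by
      intro I J hI hJ hlt
      obtain ⟨e, heJ, heI, he⟩ : ∃ e ∈ J, e ∉ I ∧ ∀ F ∈ 𝒞, (I ∩ F).ncard = ρ F → e ∉ F := by
        by_cases hT : ∃ F ∈ 𝒞, (I ∩ F).ncard = ρ F
        · obtain ⟨T, hT⟩ := Set.Finite.exists_maximal
            (s := {F ∈ 𝒞 | (I ∩ F).ncard = ρ F}) (Set.toFinite _) hT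
          have h1 : (I \ T).ncard < (J \ T).ncard := by
            have h2 := Set.ncard_inter_add_ncard_sdiff_eq_ncard I T
            have h3 := Set.ncard_inter_add_ncard_sdiff_eq_ncard J T
            have h4 := hJ.2 T hT.1.1
            have h5 := hT.1.2
            omega
          obtain ⟨e, he, heI⟩ := Set.exists_mem_notMem_of_ncard_lt_ncard h1
          refine ⟨e, he.1, fun h => heI ⟨h, he.2⟩, fun F hF hFt heF => he.2 ?_⟩
          rcases h𝒞.total hF hT.1.1 with h | h
          · exact h heF
          · exact hT.2 ⟨hF, hFt⟩ h heF
        · obtain ⟨e, he, heI⟩ := Set.exists_mem_notMem_of_ncard_lt_ncard hlt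
          exact ⟨e, he, heI, fun F hF h => absurd ⟨F, hF, h⟩ hT⟩
      refine ⟨e, heJ, heI, Set.insert_subset (hJ.1 heJ) hI.1, fun F hF => ?_⟩
      by_cases heF : e ∈ F
      · have h1 : (I ∩ F).ncard < ρ F := lt_of_le_of_ne (hI.2 F hF) fun h => he F hF h heF
        rw [Set.insert_inter_of_mem heF]
        exact (Set.ncard_insert_le _ _).trans h1
      · rw [Set.insert_inter_of_notMem heF]
        exact hI.2 F hF)
    (fun I hI => hI.1)).matroid

variable {E : Set α} {𝒞 : Set (Set α)} {h𝒞 : IsChain (· ⊆ ·) 𝒞} {ρ : Set α → ℕ}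

lemma nestedMatroid_indep_iff {I : Set α} :
    (nestedMatroid E 𝒞 h𝒞 ρ).Indep I ↔ I ⊆ E ∧ ∀ F ∈ 𝒞, (I ∩ F).ncard ≤ ρ F := by
  simp [nestedMatroid]

end NestedMatroid

/-! ### Existence and uniqueness of the Schubert matroid of a chain -/

section ChainMatroid

variable {α : Type*} [Finite α]

variable {M S : Matroid α} {C : BoundedChain (CyclicFlats M)}

/-- The Schubert matroid attached to a chain of cyclic flats. -/
noncomputable def chainMatroid (M : Matroid α) (C : BoundedChain (CyclicFlats M)) : Matroid α :=
  nestedMatroid M.E _ (isChain_image_val C) fun F => (M.eRk F).toNat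

lemma chainMatroid_indep_iff {I : Set α} : (chainMatroid M C).Indep I ↔
    I ⊆ M.E ∧ ∀ F ∈ C.1, (I ∩ F.1).encard ≤ M.eRk F.1 := by
  simp only [chainMatroid, nestedMatroid_indep_iff, Set.forall_mem_image, encard_le_eRk_iff]

lemma Matroid.Indep.chainMatroid_indep {I : Set α} (hI : M.Indep I) :
    (chainMatroid M C).Indep I :=
  chainMatroid_indep_iff.2 ⟨hI.subset_ground, fun _ _ =>
    (hI.subset Set.inter_subset_left).encard_le_eRk_of_subset Set.inter_subset_right⟩

lemma eRk_le_eRk_chainMatroid (X : Set α) : M.eRk X ≤ (chainMatroid M C).eRk X := by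
  rw [Matroid.eRk_le_iff]
  exact fun I hIX hI => hI.chainMatroid_indep.encard_le_eRk_of_subset hIX

lemma eRk_chainMatroid_eq {F : CyclicFlats M} (hF : F ∈ C.1) :
    (chainMatroid M C).eRk F.1 = M.eRk F.1 := by
  refine le_antisymm ?_ (eRk_le_eRk_chainMatroid _)
  rw [Matroid.eRk_le_iff]
  intro I hIF hI
  have := (chainMatroid_indep_iff.1 hI).2 F hF
  rwa [Set.inter_eq_left.2 hIF] at this

lemma eRank_chainMatroid : (chainMatroid M C).eRank = M.eRank := by
  rw [← Matroid.eRk_ground, ← Matroid.eRk_ground]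
  refine le_antisymm ?_ (eRk_le_eRk_chainMatroid _)
  rw [Matroid.eRk_le_iff]
  intro I hIE hI
  -- The maximal cyclic flat `K` belongs to `C`, so `|I ∩ K| ≤ rk K`; outside `K` there are at most
  -- `rk E - rk K` elements.
  have h1 := (chainMatroid_indep_iff.1 hI).2 _ (C.2.2.2 _ (isTop_cyclicPart_ground M))
  have h2 := encard_inter_add_eRk_cyclicPart_le M I M.E subset_rfl
  have hIE' : I ∩ M.E = I := Set.inter_eq_left.2 hIE
  rw [hIE', encard_eq_natCast, encard_eq_natCast, eRk_eq_natCast, eRk_eq_natCast _ M.E] at h2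
  rw [encard_le_eRk_iff] at h1 ⊢
  norm_cast at h2
  dsimp only at h1
  omega

/-- Ranks in the chain matroid are at least those in `M`, with equality on `F`. Hence adding an
element outside `F` still raises the rank, and deleting one from `F` still does not lower it. -/
lemma isCyclicFlat_chainMatroid {F : CyclicFlats M} (hF : F ∈ C.1) :
    IsCyclicFlat (chainMatroid M C) F.1 := by
  have hFE : F.1 ⊆ (chainMatroid M C).E := F.2.1.subset_ground
  have hlt : ∀ X, (chainMatroid M C).eRk F.1 = (chainMatroid M C).eRk X → ¬ M.eRk F.1 + 1 ≤
      (chainMatroid M C).eRk X := by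
    intro X hX h
    rw [← hX, eRk_chainMatroid_eq hF, eRk_eq_natCast] at h
    norm_cast at h
    omega
  rw [isCyclicFlat_iff, Matroid.isFlat_iff_closure_eq]
  constructor
  · refine Set.Subset.antisymm (fun e he => ?_) (Matroid.subset_closure _ _ hFE)
    by_contra heF
    have heE : e ∈ M.E := (chainMatroid M C).closure_subset_ground _ he
    refine hlt (insert e F.1) (le_antisymm (Matroid.eRk_mono _ (Set.subset_insert _ _)) ?_) ?_
    · rw [← Matroid.eRk_closure_eq _ F.1]
      exact Matroid.eRk_mono _ (Set.insert_subset he (Matroid.subset_closure _ _ hFE))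
    · rw [← Matroid.eRk_insert_eq_add_one ⟨heE, F.2.1.closure.symm ▸ heF⟩]
      exact eRk_le_eRk_chainMatroid _
  · refine (cyclicPart_subset _ _).antisymm fun e he => ?_
    obtain ⟨X, ⟨hX, hXF⟩, heX⟩ : e ∈ cyclicPart M F.1 := (isCyclicFlat_iff.1 F.2).2.symm ▸ he
    have hins : insert e (F.1 \ {e}) = F.1 := by simp [he]
    have hcl : e ∈ M.closure (F.1 \ {e}) :=
      M.closure_subset_closure (Set.sdiff_subset_sdiff_left hXF)
        (hX.mem_closure_sdiff_singleton_of_mem heX)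
    have hrk : M.eRk (F.1 \ {e}) = M.eRk F.1 := by
      refine le_antisymm (M.eRk_mono Set.sdiff_subset) ?_
      rw [← M.eRk_closure_eq (F.1 \ {e})]
      refine M.eRk_mono ?_
      conv_lhs => rw [← hins]
      exact Set.insert_subset hcl (M.subset_closure _ (Set.sdiff_subset.trans F.2.1.subset_ground))
    have hS : e ∈ (chainMatroid M C).closure (F.1 \ {e}) := by
      by_contra h
      have h1 := Matroid.eRk_insert_eq_add_one (M := chainMatroid M C) ⟨hFE he, h⟩
      rw [hins] at h1
      refine hlt _ rfl ?_
      rw [h1, ← hrk]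
      gcongr
      exact eRk_le_eRk_chainMatroid _
    obtain ⟨Y, hYF, hY, heY⟩ := Matroid.exists_isCircuit_of_mem_closure hS (by simp)
    rw [hins] at hYF
    exact hY.subset_cyclicPart hYF heY

/-- Every circuit of the Schubert matroid spans a member of the chain. -/
lemma exists_closure_eq_of_isCircuit {X : Set α} (hX : (chainMatroid M C).IsCircuit X) :
    ∃ F ∈ C.1, (chainMatroid M C).closure X = F.1 := by
  have h := hX.not_indep
  rw [chainMatroid_indep_iff, not_and] at h
  have hXE : X ⊆ M.E := hX.subset_ground
  specialize h hXE
  push Not at h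
  obtain ⟨F, hF, hlt⟩ := h
  refine ⟨F, hF, ?_⟩
  -- `X ∩ F` already violates the bound at `F`, so minimality of the circuit gives `X ⊆ F`. Then `rk
  -- F ≤ |X| - 1 = rk X`, and `X` spans `F`.
  have hXF : X ∩ F.1 = X := by
    refine hX.eq_of_not_indep_subset (fun hI => ?_) Set.inter_subset_left
    have := (chainMatroid_indep_iff.1 hI).2 F hF
    rw [Set.inter_assoc, Set.inter_self] at this
    exact this.not_gt hlt
  rw [hXF, ← eRk_chainMatroid_eq hF, ← hX.eRk_add_one_eq] at hlt
  rw [← (isCyclicFlat_chainMatroid hF).1.closure]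
  refine Matroid.IsRkFinite.closure_eq_closure_of_subset_of_eRk_ge_eRk ?_
    (Set.inter_eq_left.1 hXF) (ENat.lt_add_one_iff ?_ |>.1 hlt)
  · exact Matroid.eRk_ne_top_iff.1 (by rw [eRk_eq_natCast]; exact ENat.natCast_ne_top _)
  · rw [eRk_eq_natCast]; exact ENat.natCast_ne_top _

/-- Each circuit inside a cyclic flat `X` spans a member of `C` inside `X`, so `X` is the largest
member of `C` that it contains. Such members exist because `C` contains the loops of `M`. -/
lemma isCyclicFlat_chainMatroid_iff {X : Set α} :
    IsCyclicFlat (chainMatroid M C) X ↔ X ∈ (Subtype.val '' C.1 : Set (Set α)) := by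
  refine ⟨fun h => ?_, ?_⟩
  · have hL : M.loops ⊆ X := by
      rw [← h.1.closure]
      refine Set.Subset.trans ?_ (Matroid.closure_subset_closure _ (Set.empty_subset _))
      refine (Matroid.eRk_eq_zero_iff (M := chainMatroid M C)
        (hX := (isCyclicFlat_loops M).1.subset_ground)).1 ?_
      exact (eRk_chainMatroid_eq (C.2.2.1 _ (isBot_loops M))).trans M.eRk_loops
    obtain ⟨F, hF⟩ := Set.Finite.exists_maximal (s := {F ∈ C.1 | F.1 ⊆ X}) (Set.toFinite _)
      ⟨_, C.2.2.1 _ (isBot_loops M), hL⟩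
    refine ⟨F, hF.1.1, hF.1.2.antisymm ?_⟩
    rw [← (isCyclicFlat_iff.1 h).2]
    refine Set.sUnion_subset fun Y hY => ?_
    obtain ⟨G, hG, hYG⟩ := exists_closure_eq_of_isCircuit hY.1
    refine (Matroid.subset_closure _ Y hY.1.subset_ground).trans ?_
    rw [hYG]
    have hGX : G.1 ⊆ X := by
      rw [← hYG, ← h.1.closure]
      exact Matroid.closure_subset_closure _ hY.2
    rcases C.2.1.total hG hF.1.1 with h | h
    · exact h
    · exact hF.2 ⟨hG, hGX⟩ h
  · rintro ⟨F, hF, rfl⟩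
    exact isCyclicFlat_chainMatroid hF

lemma isChainMatroid_chainMatroid : IsChainMatroid M C (chainMatroid M C) :=
  ⟨Set.ext fun _ => isCyclicFlat_chainMatroid_iff, fun _ hF => eRk_chainMatroid_eq hF⟩

lemma IsChainMatroid.indep_iff (h : IsChainMatroid M C S) (hE : S.E = M.E) {I : Set α}
    (hI : I ⊆ M.E) : S.Indep I ↔ ∀ F ∈ C.1, (I ∩ F.1).encard ≤ M.eRk F.1 := by
  rw [indep_iff_forall_isCyclicFlat (hE ▸ hI) I.toFinite]
  have h1 : ∀ F, IsCyclicFlat S F ↔ F ∈ (Subtype.val '' C.1 : Set (Set α)) := fun F =>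
    Set.ext_iff.1 h.1 F
  simp only [h1, Set.forall_mem_image]
  exact forall₂_congr fun F hF => by rw [h.2 F hF]

lemma IsChainMatroid.eq_chainMatroid (h : IsChainMatroid M C S) (hE : S.E = M.E) :
    S = chainMatroid M C := by
  refine Matroid.ext_indep hE fun I hI => ?_
  rw [hE] at hI
  rw [h.indep_iff hE hI, isChainMatroid_chainMatroid.indep_iff rfl hI]

end ChainMatroid

/-! ### Euler characteristic of compact convex sets -/

section EulerCharacteristic

variable {ι : Type*} [Fintype ι]

open Classical in
-- For `s` slightly above `t`, the set `K i` contains `s` iff it contains `t` and `t` is not its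
-- maximum. The claim is the relation at `t` minus the relation at `s`.
lemma sum_ite_isGreatest_eq_zero (a : ι → ℤ) (K : ι → Set ℝ) (hK : ∀ i, IsCompact (K i))
    (hconv : ∀ i, Convex ℝ (K i)) (h : ∀ t, ∑ i, (if t ∈ K i then a i else 0) = 0) (t : ℝ) :
    ∑ i, (if IsGreatest (K i) t then a i else 0) = 0 := by
  have hev : ∀ i, ∀ᶠ s in nhdsWithin t (Set.Ioi t),
      (s ∈ K i ↔ t ∈ K i ∧ ¬ IsGreatest (K i) t) := by
    intro i
    by_cases htK : t ∈ K i
    · by_cases hg : IsGreatest (K i) t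
      · filter_upwards [self_mem_nhdsWithin] with s hs
        exact iff_of_false (fun h => (hg.2 h).not_gt hs) (fun h => h.2 hg)
      · obtain ⟨u, hu, htu⟩ : ∃ u ∈ K i, t < u := by
          by_contra hne
          push Not at hne
          exact hg ⟨htK, hne⟩
        filter_upwards [Ioc_mem_nhdsGT htu] with s hs
        exact iff_of_true ((hconv i).ordConnected.out htK hu ⟨hs.1.le, hs.2⟩) ⟨htK, hg⟩
    · filter_upwards [mem_nhdsWithin_of_mem_nhds ((hK i).isClosed.isOpen_compl.mem_nhds htK)]
        with s hs
      exact iff_of_false hs fun h => htK h.1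
  obtain ⟨s, hs⟩ := (Filter.eventually_all.2 hev).exists
  have h1 : ∀ i, (if IsGreatest (K i) t then a i else 0) =
      (if t ∈ K i then a i else 0) - (if s ∈ K i then a i else 0) := by
    intro i
    by_cases hg : IsGreatest (K i) t
    · simp [hs i, hg, hg.1]
    · by_cases ht : t ∈ K i <;> simp [hs i, hg, ht]
  rw [Finset.sum_congr rfl fun i _ => h1 i, Finset.sum_sub_distrib, h t, h s, sub_zero]

open Classical in
-- A compact set has exactly one greatest element if nonempty and none otherwise, so summing over
-- the possible maxima counts the nonempty sets.
lemma sum_ite_nonempty_eq_zero_of_real (a : ι → ℤ) (K : ι → Set ℝ) (hK : ∀ i, IsCompact (K i))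
    (hconv : ∀ i, Convex ℝ (K i)) (h : ∀ t, ∑ i, (if t ∈ K i then a i else 0) = 0) :
    ∑ i, (if (K i).Nonempty then a i else 0) = 0 := by
  let T : Finset ℝ := Finset.univ.image fun i => sSup (K i)
  have h1 : ∀ i, (if (K i).Nonempty then a i else 0) =
      ∑ t ∈ T, if IsGreatest (K i) t then a i else 0 := by
    intro i
    by_cases hne : (K i).Nonempty
    · have hg := (hK i).isGreatest_sSup hne
      rw [if_pos hne, Finset.sum_eq_single (sSup (K i))]
      · rw [if_pos hg]
      · exact fun t _ ht => if_neg fun h => ht (h.unique hg)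
      · exact fun h => absurd (Finset.mem_image_of_mem _ (Finset.mem_univ i)) h
    · rw [if_neg hne, Finset.sum_eq_zero]
      exact fun t _ => if_neg fun h => hne ⟨t, h.1⟩
  rw [Finset.sum_congr rfl fun i _ => h1 i, Finset.sum_comm]
  exact Finset.sum_eq_zero fun t _ => sum_ite_isGreatest_eq_zero a K hK hconv h t

open Classical in
/-- The Euler characteristic of compact convex sets respects linear relations between their
indicator functions. -/
lemma sum_ite_nonempty_eq_zero (n : ℕ) (a : ι → ℤ) (K : ι → Set (Fin n → ℝ))
    (hK : ∀ i, IsCompact (K i)) (hconv : ∀ i, Convex ℝ (K i))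
    (h : ∀ x, ∑ i, (if x ∈ K i then a i else 0) = 0) :
    ∑ i, (if (K i).Nonempty then a i else 0) = 0 := by
  induction n with
  | zero =>
    refine Eq.trans ?_ (h 0)
    refine Finset.sum_congr rfl fun i _ => if_congr ⟨?_, fun hx => ⟨0, hx⟩⟩ rfl rfl
    rintro ⟨x, hx⟩
    rwa [Subsingleton.elim 0 x]
  | succ n ih =>
    let tl : (Fin (n + 1) → ℝ) →ₗ[ℝ] (Fin n → ℝ) := LinearMap.funLeft ℝ ℝ Fin.succ
    have htl : Continuous tl := tl.continuous_of_finiteDimensional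
    have hcons : ∀ x : Fin n → ℝ, Continuous fun t : ℝ => (Fin.cons t x : Fin (n + 1) → ℝ) :=
      fun x => by fun_prop
    -- Forgetting the first coordinate, `x` lies in the image of `K i` iff the fibre over `x` is
    -- nonempty; the one-dimensional case on fibres gives the relation for the images.
    have key := ih (fun i => tl '' K i) (fun i => (hK i).image htl)
      (fun i => (hconv i).linear_image tl) fun x => ?_
    · simpa only [Set.image_nonempty] using key
    · have h1 := sum_ite_nonempty_eq_zero_of_real a
        (fun i => {t : ℝ | (Fin.cons t x : Fin (n + 1) → ℝ) ∈ K i}) (fun i => ?_) (fun i => ?_)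
        fun t => h (Fin.cons t x)
      · refine Eq.trans ?_ h1
        refine Finset.sum_congr rfl fun i _ => if_congr ⟨?_, ?_⟩ rfl rfl
        · rintro ⟨y, hy, rfl⟩
          refine ⟨y 0, ?_⟩
          have : (Fin.cons (y 0) (tl y) : Fin (n + 1) → ℝ) = y := Fin.cons_self_tail y
          rw [Set.mem_ofPred_eq, this]
          exact hy
        · rintro ⟨t, ht⟩
          exact ⟨_, ht, rfl⟩
      · refine ((hK i).image (continuous_apply 0)).of_isClosed_subset
          ((hK i).isClosed.preimage (hcons x)) fun t ht => ⟨_, ht, rfl⟩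
      · intro s hs t ht u v hu hv huv
        have := hconv i hs ht hu hv huv
        rw [Set.mem_ofPred_eq]
        convert this using 1
        ext j
        refine Fin.cases ?_ (fun j => ?_) j
        · simp
        · simp [← add_mul, huv]

end EulerCharacteristic

/-! ### Valuativity of `g` -/

section Valuative

variable {r n : ℕ}

lemma basePolytope_eq_convexHull_image (M : Matroid (Fin n)) :
    basePolytope M = convexHull ℝ ((fun B : Set (Fin n) => B.indicator 1) '' {B | M.IsBase B}) := by
  refine congrArg _ (Set.ext fun x => ?_)
  exact exists_congr fun B => and_congr_right fun _ => eq_comm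

lemma isCompact_basePolytope (M : Matroid (Fin n)) : IsCompact (basePolytope M) := by
  rw [basePolytope_eq_convexHull_image]
  exact (Set.toFinite _).isCompact_convexHull ℝ

lemma basePolytope_nonempty (M : Matroid (Fin n)) : (basePolytope M).Nonempty :=
  convexHull_nonempty_iff.2 <| M.exists_isBase.imp' (fun B => B.indicator 1)
    fun B hB => ⟨B, hB, rfl⟩

lemma indicator_mem_extremePoints_pi_Icc (B : Set (Fin n)) :
    B.indicator (1 : Fin n → ℝ) ∈
      Set.extremePoints ℝ (Set.univ.pi fun _ => Set.Icc (0 : ℝ) 1) := by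
  rw [extremePoints_pi]
  intro i _
  rw [Set.extremePoints_Icc zero_le_one]
  by_cases hi : i ∈ B <;> simp [hi]

/-- The zero-one points of the base polytope are the indicator vectors of the bases. -/
lemma indicator_mem_basePolytope_iff (M : Matroid (Fin n)) (B : Set (Fin n)) :
    B.indicator (1 : Fin n → ℝ) ∈ basePolytope M ↔ M.IsBase B := by
  refine ⟨fun h => ?_, fun h => subset_convexHull ℝ _ ⟨B, h, rfl⟩⟩
  have hsub : basePolytope M ⊆ Set.univ.pi fun _ => Set.Icc (0 : ℝ) 1 := by
    refine convexHull_min ?_ (convex_pi fun _ _ => convex_Icc 0 1)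
    rintro _ ⟨A, -, rfl⟩ i -
    by_cases hi : i ∈ A <;> simp [hi]
  -- A vertex of the cube lying in the smaller polytope is extreme there, hence one of its
  -- generators.
  have hext := inter_extremePoints_subset_extremePoints_of_subset hsub
    ⟨h, indicator_mem_extremePoints_pi_Icc B⟩
  obtain ⟨A, hA, hAB⟩ := extremePoints_convexHull_subset hext
  have : B = A := Set.ext fun i => by
    have := congrFun hAB i
    by_cases h1 : i ∈ A <;> by_cases h2 : i ∈ B <;> simp_all
  rwa [this]

lemma isValuative_basisIndicator (B : Finset (Fin n)) :
    IsValuative (r := r) (basisIndicator B) := by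
  classical
  intro s a M h
  rw [← h ((B : Set (Fin n)).indicator 1)]
  refine Finset.sum_congr rfl fun i _ => ?_
  rw [smul_eq_mul, basisIndicator, Set.indicator_apply]
  refine congrArg _ (if_congr ?_ rfl rfl)
  exact (indicator_mem_basePolytope_iff _ _).symm

/-- Needed for the summands `1 - f_B`: a relation between indicator functions of base polytopes has
coefficient sum 0. -/
lemma isValuative_one : IsValuative (fun _ : LabelledMatroid r n => (1 : ℤ)) := by
  classical
  intro s a M h
  have h1 := sum_ite_nonempty_eq_zero n a (fun i => basePolytope (M i).1)
    (fun i => isCompact_basePolytope _) (fun i => convex_convexHull ℝ _) fun x => by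
      refine Eq.trans ?_ (h x)
      refine Finset.sum_congr rfl fun i _ => ?_
      rw [Set.indicator_apply]
      split_ifs <;> simp
  rw [← h1]
  refine Finset.sum_congr rfl fun i _ => ?_
  rw [if_pos (basePolytope_nonempty _), smul_eq_mul, mul_one]

lemma IsValuative.sub {A : Type*} [AddCommGroup A] {f g : LabelledMatroid r n → A}
    (hf : IsValuative f) (hg : IsValuative g) : IsValuative fun N => f N - g N := by
  intro s a M h
  simp only [smul_sub, Finset.sum_sub_distrib, hf s a M h, hg s a M h, sub_zero]

lemma IsValuative.sum {A κ : Type*} [AddCommGroup A] {t : Finset κ}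
    {f : κ → LabelledMatroid r n → A} (hf : ∀ k ∈ t, IsValuative (f k)) :
    IsValuative fun N => ∑ k ∈ t, f k N := by
  intro s a M h
  simp only [Finset.smul_sum]
  rw [Finset.sum_comm]
  exact Finset.sum_eq_zero fun k hk => hf k hk s a M h

lemma isValuative_basisAgreement (M : LabelledMatroid r n) : IsValuative (basisAgreement M) := by
  refine IsValuative.sum fun B _ => ?_
  split_ifs
  · exact isValuative_basisIndicator B
  · exact isValuative_one.sub (isValuative_basisIndicator B)

end Valuative

/-! ### Expansion of `f_B` and `g` over Schubert matroids -/

section SchubertExpansion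

variable {r n : ℕ}

instance : Finite (LabelledMatroid r n) := by
  have : Finite (Matroid (Fin n)) := by
    refine Finite.of_injective (fun M : Matroid (Fin n) => (M.E, M.IsBase)) fun M N h => ?_
    obtain ⟨h1, h2⟩ := Prod.ext_iff.1 h
    exact Matroid.ext_isBase h1 fun B _ => iff_of_eq (congrFun h2 B)
  exact Subtype.finite

instance : Finite (SchubertMatroid r n) := Subtype.finite

lemma LabelledMatroid.isBase_iff_indep (N : LabelledMatroid r n) {B : Finset (Fin n)}
    (hB : B.card = r) : N.1.IsBase B ↔ N.1.Indep B := by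
  refine ⟨fun h => h.indep, fun h => h.isBase_of_eRk_ge B.finite_toSet ?_⟩
  rw [h.eRk_eq_encard, N.2.2, Set.encard_coe_eq_coe_finsetCard, hB]

lemma LabelledMatroid.card_of_isBase (N : LabelledMatroid r n) {B : Finset (Fin n)}
    (hB : N.1.IsBase B) : B.card = r := by
  have := hB.encard_eq_eRank
  rw [N.2.2, Set.encard_coe_eq_coe_finsetCard] at this
  exact_mod_cast this

/-- The Schubert matroid of a chain of cyclic flats, with its labelling. -/
noncomputable def chainSchubert (N : LabelledMatroid r n) (C : BoundedChain (CyclicFlats N.1)) :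
    SchubertMatroid r n :=
  ⟨⟨chainMatroid N.1 C, N.2.1, eRank_chainMatroid.trans N.2.2⟩, by
    rw [IsSchubert, (isChainMatroid_chainMatroid (M := N.1) (C := C)).1]
    exact isChain_image_val C⟩

lemma isChainMatroid_iff_eq_chainSchubert (N : LabelledMatroid r n)
    (C : BoundedChain (CyclicFlats N.1)) (S : SchubertMatroid r n) :
    IsChainMatroid N.1 C S.1.1 ↔ S = chainSchubert N C := by
  refine ⟨fun h => ?_, fun h => h ▸ isChainMatroid_chainMatroid⟩
  exact Subtype.ext (Subtype.ext (h.eq_chainMatroid (S.1.2.1.trans N.2.1.symm)))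

open Classical in
/-- Linear functionals on the coordinate space, evaluated at the points `p̄_N`. -/
lemma sum_schubertPoint_mul [Fintype (SchubertMatroid r n)] (N : LabelledMatroid r n)
    [Fintype (BoundedChain (CyclicFlats N.1))] (w : SchubertMatroid r n → ℤ) :
    ∑ S, schubertPoint N S * (w S : ℝ) =
      ((∑ C : BoundedChain (CyclicFlats N.1), chainCoeff N.1 C * w (chainSchubert N C) : ℤ) : ℝ) := by
  simp only [schubertPoint, schubertCoord, isChainMatroid_iff_eq_chainSchubert]
  rw [← Int.cast_inj (α := ℝ) |>.2 (Finset.sum_congr rfl fun C _ =>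
    Fintype.sum_ite_eq' (chainSchubert N C) fun S => chainCoeff N.1 C * w S)]
  push_cast
  rw [Finset.sum_comm]
  refine Finset.sum_congr rfl fun S _ => ?_
  rw [Finset.sum_mul]
  refine Finset.sum_congr (by congr!) fun C _ => ?_
  split_ifs <;> simp

lemma sum_chainCoeff (N : Matroid (Fin n)) [Fintype (BoundedChain (CyclicFlats N))] :
    ∑ C : BoundedChain (CyclicFlats N), chainCoeff N C = 1 := by
  classical
  have h := sum_neg_moebiusFn_superset (P := CyclicFlats N) (c := ∅) IsChain.empty
  rw [Finset.filter_true_of_mem fun C _ => Set.empty_subset _] at h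
  exact h

/-- The basis indicator functions respect the expansion into Schubert matroids. -/
lemma sum_chainCoeff_mul_basisIndicator (N : LabelledMatroid r n)
    [Fintype (BoundedChain (CyclicFlats N.1))] {B : Finset (Fin n)} (hB : B.card = r) :
    ∑ C : BoundedChain (CyclicFlats N.1),
      chainCoeff N.1 C * basisIndicator B (chainSchubert N C).1 = basisIndicator B N := by
  classical
  -- The cyclic flats that obstruct independence of `B`: all of them count for `N`, only those in
  -- `C` for `S_C`.
  let D : Set (CyclicFlats N.1) := {F | N.1.eRk F.1 < ((B : Set (Fin n)) ∩ F.1).encard}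
  have hBE : (B : Set (Fin n)) ⊆ N.1.E := by simp [N.2.1]
  have h1 : ∀ C : BoundedChain (CyclicFlats N.1),
      chainCoeff N.1 C * basisIndicator B (chainSchubert N C).1 =
        if Disjoint C.1 (D.toFinite.toFinset : Set (CyclicFlats N.1)) then
          -moebiusFn (C : ChainLattice (CyclicFlats N.1)) ⊤ else 0 := by
    intro C
    have h2 : (chainSchubert N C).1.1.IsBase B ↔
        Disjoint C.1 (D.toFinite.toFinset : Set (CyclicFlats N.1)) := by
      rw [LabelledMatroid.isBase_iff_indep _ hB, Set.Finite.coe_toFinset, Set.disjoint_left]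
      change (chainMatroid N.1 C).Indep B ↔ _
      rw [chainMatroid_indep_iff, and_iff_right hBE]
      exact forall₂_congr fun F _ => not_lt.symm
    rw [basisIndicator, mul_ite, mul_one, mul_zero]
    exact if_congr h2 rfl rfl
  rw [Finset.sum_congr rfl fun C _ => h1 C, ← Finset.sum_filter, sum_neg_moebiusFn_disjoint]
  have h3 : N.1.IsBase B ↔ D = ∅ := by
    rw [LabelledMatroid.isBase_iff_indep _ hB, indep_iff_forall_isCyclicFlat hBE B.finite_toSet,
      Set.eq_empty_iff_forall_notMem, Subtype.forall]
    exact forall₂_congr fun F _ => not_lt.symm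
  rw [basisIndicator]
  split_ifs with hb
  · rw [Finset.sum_eq_single ∅]
    · simp
    · intro c hc hne
      refine absurd (Finset.subset_empty.1 ((mem_chainsIn.1 hc).1.trans ?_)) hne
      simp [h3.1 hb]
    · exact fun h => absurd (mem_chainsIn.2 ⟨Finset.empty_subset _, by simp⟩) h
  · obtain ⟨m, hm, hD⟩ := exists_forall_isGLB_of_excess N.1 B D rfl
      (Set.nonempty_iff_ne_empty.2 fun h => hb (h3.2 h))
    refine sum_chains_neg_one_pow_card_eq_zero (m := m) (D.toFinite.mem_toFinset.2 hm) fun x hx => ?_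
    obtain ⟨y, hy, h⟩ := hD x (D.toFinite.mem_toFinset.1 hx)
    exact ⟨y, D.toFinite.mem_toFinset.2 hy, h⟩

lemma sum_chainCoeff_mul_basisAgreement (M N : LabelledMatroid r n)
    [Fintype (BoundedChain (CyclicFlats N.1))] :
    ∑ C : BoundedChain (CyclicFlats N.1),
      chainCoeff N.1 C * basisAgreement M (chainSchubert N C).1 = basisAgreement M N := by
  simp only [basisAgreement, Finset.mul_sum]
  rw [Finset.sum_comm]
  refine Finset.sum_congr rfl fun B hB => ?_
  have hB' := sum_chainCoeff_mul_basisIndicator N (Finset.mem_powersetCard.1 hB).2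
  split_ifs
  · exact hB'
  · simp only [mul_sub, mul_one, Finset.sum_sub_distrib, hB', sum_chainCoeff]

end SchubertExpansion

/-! ### The strict maximum of `g` -/

section Agreement

variable {r n : ℕ}

open Classical in
-- In this form `g` counts agreements, so its maximum forces equal sets of bases.
lemma basisAgreement_eq_sum (M N : LabelledMatroid r n) :
    basisAgreement M N = ∑ B ∈ Finset.powersetCard r (Finset.univ : Finset (Fin n)),
      if (M.1.IsBase (B : Set (Fin n)) ↔ N.1.IsBase (B : Set (Fin n))) then 1 else 0 := by
  refine Finset.sum_congr rfl fun B _ => ?_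
  rw [basisIndicator]
  split_ifs <;> simp_all

lemma basisAgreement_self (M : LabelledMatroid r n) : basisAgreement M M = (n.choose r : ℤ) := by
  simp [basisAgreement_eq_sum]

lemma basisAgreement_lt (M N : LabelledMatroid r n) (h : N ≠ M) :
    basisAgreement M N < (n.choose r : ℤ) := by
  classical
  rw [← basisAgreement_self M, basisAgreement_eq_sum, basisAgreement_eq_sum]
  obtain ⟨B, hB⟩ : ∃ B : Set (Fin n), ¬ (M.1.IsBase B ↔ N.1.IsBase B) := by
    by_contra! hne
    exact h (Subtype.ext (Matroid.ext_isBase (N.2.1.trans M.2.1.symm) fun B _ => (hne B).symm))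
  lift B to Finset (Fin n) using B.toFinite
  refine Finset.sum_lt_sum (fun A _ => by split_ifs <;> simp_all) ⟨B, ?_, by simp [hB]⟩
  rw [Finset.mem_powersetCard]
  refine ⟨Finset.subset_univ _, ?_⟩
  by_cases hM : M.1.IsBase B
  · exact M.card_of_isBase hM
  · exact N.card_of_isBase (by tauto)

end Agreement

/-! ### Strict maxima over convex hulls, and the theorem -/

/-- A linear functional that attains its strict maximum over a set at `p` also does so over the
convex hull. -/
lemma lt_of_mem_convexHull_of_ne {E : Type*} [AddCommGroup E] [Module ℝ E] {s : Set E} {p : E}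
    (φ : E →ₗ[ℝ] ℝ) (h : ∀ x ∈ s, x ≠ p → φ x < φ p) {x : E} (hx : x ∈ convexHull ℝ s)
    (hxp : x ≠ p) : φ x < φ p := by
  have hconv : Convex ℝ {x | x ≠ p → φ x < φ p} := by
    intro x hx y hy a b ha hb hab hne
    have hle : ∀ z ∈ {x | x ≠ p → φ x < φ p}, φ z ≤ φ p := fun z hz => by
      by_cases hzp : z = p
      · rw [hzp]
      · exact (hz hzp).le
    rw [map_add, map_smul, map_smul, smul_eq_mul, smul_eq_mul]
    have hp : a * φ p + b * φ p = φ p := by rw [← add_mul, hab, one_mul]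
    have hx' := hle x hx
    have hy' := hle y hy
    -- Strictness must come from a point other than `p` with positive weight, so zero weights are
    -- treated apart.
    rcases ha.eq_or_lt with rfl | ha
    · obtain rfl : b = 1 := by linarith
      simp only [zero_smul, one_smul, zero_add] at hne
      simpa using hy hne
    · by_cases hxp : x = p
      · rcases hb.eq_or_lt with rfl | hb
        · obtain rfl : a = 1 := by linarith
          simp [hxp] at hne
        · have hyp : y ≠ p := by
            rintro rfl
            exact hne (by rw [hxp, ← add_smul, hab, one_smul])
          have := hy hyp
          linarith [mul_lt_mul_of_pos_left this hb, mul_le_mul_of_nonneg_left hx' ha.le]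
      · have := hx hxp
        linarith [mul_lt_mul_of_pos_left this ha, mul_le_mul_of_nonneg_left hy' hb]
  exact convexHull_min (t := {x | x ≠ p → φ x < φ p}) h hconv hx hxp

lemma mem_extremePoints_of_forall_lt {E : Type*} [AddCommGroup E] [Module ℝ E] {s : Set E} {p : E}
    (φ : E →ₗ[ℝ] ℝ) (hp : p ∈ s) (h : ∀ x ∈ s, x ≠ p → φ x < φ p) :
    p ∈ Set.extremePoints ℝ s := by
  refine ⟨hp, fun x hx y hy hxy => ?_⟩
  by_contra hne
  obtain ⟨a, b, ha, hb, hab, rfl⟩ := hxy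
  have h1 := h x hx hne
  have h2 : φ y ≤ φ (a • x + b • y) := by
    by_cases hyp : y = a • x + b • y
    · rw [← hyp]
    · exact (h y hy hyp).le
  have h3 : φ (a • x + b • y) = a * φ x + b * φ y := by simp
  have h4 : a * φ (a • x + b • y) + b * φ (a • x + b • y) = φ (a • x + b • y) := by
    rw [← add_mul, hab, one_mul]
  linarith [mul_lt_mul_of_pos_left h1 ha, mul_le_mul_of_nonneg_left h2 hb.le]

theorem theorem4p2 (r n : ℕ) (M : LabelledMatroid r n) :
    schubertPoint M ∈ Set.extremePoints ℝ (omegaBar r n) ∧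
      IsValuative (basisAgreement M) ∧
      basisAgreement M M = (n.choose r : ℤ) ∧
      (∀ N : LabelledMatroid r n, N ≠ M → basisAgreement M N < (n.choose r : ℤ)) ∧
      ∃ φ : (SchubertMatroid r n → ℝ) →ₗ[ℝ] ℝ,
        (∀ N : LabelledMatroid r n, φ (schubertPoint N) = (basisAgreement M N : ℝ)) ∧
        ∀ x ∈ omegaBar r n, x ≠ schubertPoint M → φ x < (n.choose r : ℝ) := by
  classical
  let _ : Fintype (SchubertMatroid r n) := Fintype.ofFinite _
  let φ : (SchubertMatroid r n → ℝ) →ₗ[ℝ] ℝ :=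
    ∑ S, (basisAgreement M S.1 : ℝ) • LinearMap.proj S
  have hφ : ∀ N : LabelledMatroid r n, φ (schubertPoint N) = (basisAgreement M N : ℝ) := by
    intro N
    let _ : Fintype (BoundedChain (CyclicFlats N.1)) := Fintype.ofFinite _
    rw [← sum_chainCoeff_mul_basisAgreement M N,
      ← sum_schubertPoint_mul N fun S => basisAgreement M S.1]
    simp [φ, mul_comm]
  have hφM : φ (schubertPoint M) = (n.choose r : ℝ) := by
    rw [hφ, basisAgreement_self, Int.cast_natCast]
  have hlt : ∀ x ∈ omegaBar r n, x ≠ schubertPoint M → φ x < φ (schubertPoint M) := by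
    refine fun x hx hne => lt_of_mem_convexHull_of_ne φ ?_ hx hne
    rintro _ ⟨N, rfl⟩ hN
    have := basisAgreement_lt M N fun h => hN (h ▸ rfl)
    rw [hφM, hφ]
    exact_mod_cast this
  exact ⟨mem_extremePoints_of_forall_lt φ (subset_convexHull ℝ _ ⟨M, rfl⟩) hlt,
    isValuative_basisAgreement M, basisAgreement_self M, basisAgreement_lt M,
    φ, hφ, fun x hx hne => hφM ▸ hlt x hx hne⟩
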